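/- Let $(\Omega,\mathcal F,\mathbf P)$ and $(\Omega',\mathcal F',\mathbf P')$ be probability spaces. Let $Y=(Y_t)_{t\ge 0}$ be a fractional Brownian motion on $(\Omega',\mathcal F',\mathbf P')$ with Hurst parameter $H\in(0,1)$ and scale $\sigma>0$, that is, a centered Gaussian process with almost surely continuous paths and covariance $\frac{\sigma^2}{2}\left(s^{2H}+t^{2H}-|t-s|^{2H}\right)$. Let $M_0$ be a Gaussian random measure on $\mathbb R$ with Lebesgue control measure, defined on $(\Omega,\mathcal F,\mathbf P)$: for Borel sets $A$ of finite Lebesgue measure $|A|$, $M_0(A)$ is a centered Gaussian random variable with variance $|A|$, the values of $M_0$ on finitely many disjoint sets are independent, and $M_0$ is almost surely $\sigma$-additive along every sequence of disjoint sets whose union has finite measure. On the product space $(\Omega\times\Omega',\mathbf P\times\mathbf P')$ let $$Y^{(-)}_t=\int_{\mathbb R}1_{[0,Y_t(\omega')]}(x)\,M_0(dx),\qquad t\ge 0,$$ where $[0,y]$ denotes the closed interval between $0$ and $y$ whatever the sign of $y$, and where for fixed $\omega'$ the integral is the $L^2$ stochastic integral of a deterministic function against $M_0$. Let $\tau_t=\inf\{s\ge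 0: Y_s=t\}$ for $t\ge 0$. Then almost surely $\tau_t<\infty$ for all $t\ge 0$; the process $Y^{(-)}$ has a modification with almost surely continuous paths, which can be chosen jointly measurable and such that for almost every $\omega'$ the above formula holds $\mathbf P$-almost surely for each $t\ge 0$; and for every modification of $Y^{(-)}$ with almost surely continuous paths, the time-changed process $(Y^{(-)}_{\tau_t})_{t\ge 0}$ is a standard Brownian motion (with almost surely continuous paths). Moreover, for every jointly measurable process $Y^{(-)}$, continuous or not, for which, for almost every $\omega'$, the above formula holds $\mathbf P$-almost surely for each $t\ge 0$, the process $(Y^{(-)}_{\tau_t})_{t\ge 0}$ has the finite-dimensional distributions of a standard Brownian motion. -/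

import Mathlib

open MeasureTheory ProbabilityTheory Filter Topology
open scoped NNReal ENNReal

/-- `Y` is a fractional Brownian motion with Hurst parameter `H` and scale `σ` (so that
`E[Y_1 ^ 2] = σ ^ 2`): a centered Gaussian process with the fractional covariance and almost surely
continuous paths. -/
structure IsFractionalBrownian {Ω : Type*} [MeasurableSpace Ω] (H σ : ℝ)
    (Y : ℝ≥0 → Ω → ℝ) (P : Measure Ω) : Prop where
  gaussian : IsGaussianProcess Y P
  centered : ∀ t, P[Y t] = 0
  covariance : ∀ s t : ℝ≥0, cov[Y s, Y t; P] =
    σ ^ 2 / 2 * ((s : ℝ) ^ (2 * H) + (t : ℝ) ^ (2 * H) - |(t : ℝ) - (s : ℝ)| ^ (2 * H))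
  cont : ∀ᵐ ω ∂P, Continuous (fun t => Y t ω)

/-- `M` is a Gaussian random measure with control measure `m`: on measurable sets `A` of finite
`m`-measure, `M A` is a centered Gaussian variable of variance `m A`; the values of `M` on disjoint
sets are independent; and `M` is almost surely `σ`-additive along each disjoint sequence whose
union has finite measure. (The values of `M` on other sets are irrelevant.) -/
structure IsGaussianRandomMeasure {E Ω : Type*} [MeasurableSpace E] [MeasurableSpace Ω]
    (M : Set E → Ω → ℝ) (m : Measure E) (P : Measure Ω) : Prop where
  hasLaw : ∀ A : Set E, MeasurableSet A → m A < ∞ →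
    HasLaw (M A) (gaussianReal 0 (m A).toNNReal) P
  indep : ∀ (n : ℕ) (A : Fin n → Set E), (∀ i, MeasurableSet (A i)) → (∀ i, m (A i) < ∞) →
    Pairwise (fun i j => Disjoint (A i) (A j)) → iIndepFun (fun i => M (A i)) P
  sigma_additive : ∀ A : ℕ → Set E, (∀ i, MeasurableSet (A i)) →
    Pairwise (fun i j => Disjoint (A i) (A j)) → m (⋃ i, A i) < ∞ →
    ∀ᵐ ω ∂P, Tendsto (fun n => ∑ i ∈ Finset.range n, M (A i) ω) atTop (𝓝 (M (⋃ i, A i) ω))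

/-- The integral `∑ y, y * M {φ = y}` of a simple function `φ` against a random measure `M`.
The level set of `y = 0`, which may have infinite measure, does not contribute. -/
noncomputable def simpleRandomIntegral {E Ω : Type*} [MeasurableSpace E]
    (M : Set E → Ω → ℝ) (φ : SimpleFunc E ℝ) (ω : Ω) : ℝ :=
  ∑ y ∈ φ.range, y * M (φ ⁻¹' {y}) ω

/-- The random variable `Z` is (a version of) the integral `∫ f dM` of the square integrable
deterministic function `f` against the Gaussian random measure `M` with control measure `m`:
the limit in probability of the integrals of simple functions that converge to `f` in `L²(m)`. -/
def IsRandomMeasureIntegral {E Ω : Type*} [MeasurableSpace E] [MeasurableSpace Ω]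
    (M : Set E → Ω → ℝ) (m : Measure E) (P : Measure Ω) (f : E → ℝ) (Z : Ω → ℝ) : Prop :=
  MemLp f 2 m ∧ ∃ φ : ℕ → SimpleFunc E ℝ, (∀ n, MemLp (φ n) 2 m) ∧
    Tendsto (fun n => eLpNorm (fun x => φ n x - f x) 2 m) atTop (𝓝 0) ∧
    TendstoInMeasure P (fun n => simpleRandomIntegral M (φ n)) atTop Z

/-- The random variable `Z` on the product space is (a version of) the integral
`∫ κ(ω', x) M(dx)` of a random kernel `κ`, living on `(Ω', P')`, against a Gaussian random measure
`M` living on `(Ω, P)`, hence independent of `κ`: for almost every fixed `ω'`,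
it is the integral of the deterministic function `κ(ω', ·)`. -/
def IsRandomKernelIntegral {E Ω Ω' : Type*} [MeasurableSpace E] [MeasurableSpace Ω]
    [MeasurableSpace Ω'] (M : Set E → Ω → ℝ) (m : Measure E) (P : Measure Ω) (P' : Measure Ω')
    (κ : Ω' → E → ℝ) (Z : Ω × Ω' → ℝ) : Prop :=
  AEMeasurable Z (P.prod P') ∧
    ∀ᵐ ω' ∂P', IsRandomMeasureIntegral M m P (κ ω') (fun ω => Z (ω, ω'))

/-- The kernel `1_{[0, y]}`, where `[0, y]` is the interval between `0` and `y` whatever the sign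
of `y`. -/
noncomputable def intervalKernel (y : ℝ) : ℝ → ℝ := (Set.uIcc 0 y).indicator (fun _ => 1)

/-- `Z` is a continuous modification of the process `t ↦ ∫ 1_{[0, Y_t]} dM`. -/
structure IsContinuousRandomTimeProcess {Ω Ω' : Type*} [MeasurableSpace Ω] [MeasurableSpace Ω']
    (M : Set ℝ → Ω → ℝ) (P : Measure Ω) (Y : ℝ≥0 → Ω' → ℝ) (P' : Measure Ω')
    (Z : ℝ≥0 → Ω × Ω' → ℝ) : Prop where
  integral : ∀ t, IsRandomKernelIntegral M volume P P' (fun ω' => intervalKernel (Y t ω')) (Z t)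
  cont : ∀ᵐ p ∂(P.prod P'), Continuous (fun t => Z t p)

/-- `Z` is the process `t ↦ ∫ 1_{[0, Y_t]} dM` defined separately for each path of `Y`, without any
continuity: a jointly measurable process such that, for almost every `ω'` and all times `t`,
the variable `Z_t(·, ω')` is the integral of the deterministic kernel `1_{[0, Y_t(ω')]}`. -/
structure IsPathwiseRandomTimeProcess {Ω Ω' : Type*} [MeasurableSpace Ω] [MeasurableSpace Ω']
    (M : Set ℝ → Ω → ℝ) (P : Measure Ω) (Y : ℝ≥0 → Ω' → ℝ) (P' : Measure Ω')
    (Z : ℝ≥0 → Ω × Ω' → ℝ) : Prop where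
  measurable : Measurable (fun q : ℝ≥0 × (Ω × Ω') => Z q.1 q.2)
  integral : ∀ᵐ ω' ∂P', ∀ t,
    IsRandomMeasureIntegral M volume P (intervalKernel (Y t ω')) (fun ω => Z t (ω, ω'))

/-- The first time `τ_t = inf {s : Y_s = t}` at which `Y` is at level `t`
(with the value `0` if the level is never attained). -/
noncomputable def firstLevelTime {Ω' : Type*} (Y : ℝ≥0 → Ω' → ℝ) (t : ℝ≥0) (ω' : Ω') : ℝ≥0 :=
  sInf {s : ℝ≥0 | Y s ω' = (t : ℝ)}

/-! For a fixed path of `Y`, the isometry of the integral forces ∫ 1_{[0,y]} dM = M([0,y]) almost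
surely. The field x ↦ M([0,x]) has a continuous version `B` on the line
(`exists_continuous_version`, by dyadic chaining), and its restriction to x ≥ 0 is a Brownian motion
because M has independent values on disjoint sets. Hence Y^{(-)}_t = B(Y_t). As Y equals t at time
τ_t, the time change undoes the inner process: Y^{(-)}_{τ_t} = B(t). About the paths of Y only
continuity, Y_0 = 0 and the visit to every level t ≥ 0 matter.

Null sets need care, since τ_t is random. A continuous modification agrees with B(Y_t) at countably
many dense times, hence at all times. Without continuity, the formula holds for almost every ω' at
all times, so the time τ_t(ω') may be inserted for fixed ω'; joint measurability and the
measurability of τ_t then allow Fubini (`ae_eq_prod_of_ae_ae_eq`).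

Levels are reached because Y is unbounded above (`measureReal_forall_le_eq_zero`): normalised values
at widely spaced geometric times are nearly uncorrelated standard Gaussians, and a second moment
bound on their exponentials shows that they cannot all stay small. The intermediate value theorem
does the rest. -/

/-! ### Additivity and covariance of a Gaussian random measure -/

lemma covariance_congr_ae {Ω : Type*} [MeasurableSpace Ω] {P : Measure Ω} {X X' Z Z' : Ω → ℝ}
    (hX : X =ᵐ[P] X') (hZ : Z =ᵐ[P] Z') : cov[X, Z; P] = cov[X', Z'; P] := by
  unfold covariance
  rw [integral_congr_ae hX, integral_congr_ae hZ]
  refine integral_congr_ae ?_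
  filter_upwards [hX, hZ] with ω h1 h2
  rw [h1, h2]

namespace IsGaussianRandomMeasure

variable {E Ω : Type*} [MeasurableSpace E] [MeasurableSpace Ω] {M : Set E → Ω → ℝ}
  {m : Measure E} {P : Measure Ω} {A B : Set E}

lemma memLp_two (hM : IsGaussianRandomMeasure M m P) (hA : MeasurableSet A) (hA' : m A < ∞) :
    MemLp (M A) 2 P :=
  (hM.hasLaw A hA hA').hasGaussianLaw.memLp_two

lemma integral_eq_zero (hM : IsGaussianRandomMeasure M m P) (hA : MeasurableSet A)
    (hA' : m A < ∞) : P[M A] = 0 := by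
  rw [(hM.hasLaw A hA hA').integral_eq, integral_id_gaussianReal]

lemma variance_eq (hM : IsGaussianRandomMeasure M m P) (hA : MeasurableSet A)
    (hA' : m A < ∞) : Var[M A; P] = m.real A := by
  rw [(hM.hasLaw A hA hA').variance_eq, variance_id_gaussianReal]
  rfl

lemma empty_ae_eq (hM : IsGaussianRandomMeasure M m P) : ∀ᵐ ω ∂P, M ∅ ω = 0 := by
  have h := hM.hasLaw ∅ .empty (by simp)
  simp only [measure_empty, ENNReal.toNNReal_zero, gaussianReal_zero_var] at h
  exact h.ae_eq_of_dirac

lemma union_ae_eq (hM : IsGaussianRandomMeasure M m P) (hA : MeasurableSet A)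
    (hB : MeasurableSet B) (hAB : Disjoint A B) (h : m (A ∪ B) < ∞) :
    ∀ᵐ ω ∂P, M (A ∪ B) ω = M A ω + M B ω := by
  -- σ-additivity is applied to A, B, ∅, ∅, …; the tail vanishes since `M ∅` has the Dirac law at 0.
  let S : ℕ → Set E := fun n => if n = 0 then A else if n = 1 then B else ∅
  have hU : ⋃ i, S i = A ∪ B := by
    apply Set.Subset.antisymm
    · refine Set.iUnion_subset fun i => ?_
      simp only [S]
      split_ifs <;> simp
    · exact Set.union_subset (Set.subset_iUnion S 0) (Set.subset_iUnion S 1)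
  have hS : ∀ i, MeasurableSet (S i) := by
    intro i
    simp only [S]
    split_ifs
    exacts [hA, hB, .empty]
  have hd : Pairwise (fun i j => Disjoint (S i) (S j)) := by
    intro i j hij
    simp only [S]
    split_ifs <;> first | omega | simp [hAB.symm]
  have key := hM.sigma_additive S hS hd (by rwa [hU])
  rw [hU] at key
  filter_upwards [key, hM.empty_ae_eq] with ω h1 h0
  refine tendsto_nhds_unique h1 ?_
  refine tendsto_const_nhds.congr' ?_
  filter_upwards [eventually_ge_atTop 2] with n hn
  obtain ⟨k, rfl⟩ := Nat.exists_eq_add_of_le hn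
  have h2 : ∀ j ∈ Finset.range k, M (S (2 + j)) ω = 0 := fun j _ => by
    rw [show S (2 + j) = ∅ by simp [S, show 2 + j ≠ 1 by omega], h0]
  rw [Finset.sum_range_add, Finset.sum_eq_zero h2]
  simp [S, Finset.sum_range_succ]

lemma diff_ae_eq (hM : IsGaussianRandomMeasure M m P) (hA : MeasurableSet A)
    (hB : MeasurableSet B) (hAB : A ⊆ B) (h : m B < ∞) :
    ∀ᵐ ω ∂P, M B ω - M A ω = M (B \ A) ω := by
  have := hM.union_ae_eq hA (hB.diff hA) Set.disjoint_sdiff_right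
    (by rwa [Set.union_sdiff_cancel hAB])
  rw [Set.union_sdiff_cancel hAB] at this
  filter_upwards [this] with ω h
  rw [h]; ring

lemma indepFun_of_disjoint (hM : IsGaussianRandomMeasure M m P) (hA : MeasurableSet A)
    (hB : MeasurableSet B) (hAB : Disjoint A B) (hA' : m A < ∞) (hB' : m B < ∞) :
    IndepFun (M A) (M B) P := by
  have := hM.indep 2 ![A, B] (by simp [Fin.forall_fin_two, hA, hB])
    (by simp [Fin.forall_fin_two, hA', hB']) (by
      intro i j hij
      fin_cases i <;> fin_cases j <;> first | exact absurd rfl hij | simp [hAB, hAB.symm])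
  simpa using this.indepFun (i := 0) (j := 1) (by simp)

/-- Splitting A and B along A ∩ B gives three disjoint pieces, whose values are independent; only
the common piece contributes, by its variance. -/
lemma covariance_eq (hM : IsGaussianRandomMeasure M m P) [IsProbabilityMeasure P]
    (hA : MeasurableSet A)
    (hB : MeasurableSet B) (hA' : m A < ∞) (hB' : m B < ∞) :
    cov[M A, M B; P] = m.real (A ∩ B) := by
  have hI := hA.inter hB
  have hI' : m (A ∩ B) < ∞ := (measure_mono Set.inter_subset_left).trans_lt hA'
  have hAI : m (A \ B) < ∞ := (measure_mono Set.sdiff_subset).trans_lt hA'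
  have hBI : m (B \ A) < ∞ := (measure_mono Set.sdiff_subset).trans_lt hB'
  have h1 : M A =ᵐ[P] M (A ∩ B) + M (A \ B) := by
    have := hM.union_ae_eq hI (hA.diff hB) disjoint_inf_sdiff (by rwa [Set.inter_union_sdiff])
    rwa [Set.inter_union_sdiff] at this
  have h2 : M B =ᵐ[P] M (A ∩ B) + M (B \ A) := by
    have := hM.union_ae_eq hI (hB.diff hA) (by
      rw [Set.inter_comm]; exact disjoint_inf_sdiff)
      (by rw [Set.inter_comm]; rwa [Set.inter_union_sdiff])
    rwa [Set.inter_comm, Set.inter_union_sdiff, Set.inter_comm] at this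
  have l1 := hM.memLp_two hI hI'
  have l2 := hM.memLp_two (hA.diff hB) hAI
  have l3 := hM.memLp_two (hB.diff hA) hBI
  rw [covariance_congr_ae h1 h2, covariance_add_left l1 l2 (l1.add l3),
    covariance_add_right l1 l1 l3, covariance_add_right l2 l1 l3,
    covariance_self l1.aemeasurable, hM.variance_eq hI hI',
    (hM.indepFun_of_disjoint hI (hB.diff hA) _ hI' hBI).covariance_eq_zero l1 l3,
    (hM.indepFun_of_disjoint (hA.diff hB) hI _ hAI hI').covariance_eq_zero l2 l1,
    (hM.indepFun_of_disjoint (hA.diff hB) (hB.diff hA) _ hAI hBI).covariance_eq_zero l2 l3]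
  · simp
  all_goals
    rw [Set.disjoint_left]
    intro x
    simp +contextual

lemma integral_mul_eq (hM : IsGaussianRandomMeasure M m P) [IsProbabilityMeasure P]
    (hA : MeasurableSet A)
    (hB : MeasurableSet B) (hA' : m A < ∞) (hB' : m B < ∞) :
    ∫ ω, M A ω * M B ω ∂P = m.real (A ∩ B) := by
  rw [← hM.covariance_eq hA hB hA' hB',
    covariance_eq_sub (hM.memLp_two hA hA') (hM.memLp_two hB hB'), hM.integral_eq_zero hA hA']
  simp

/-- The **isometry property** for finite linear combinations. -/
lemma integral_sum_sq (hM : IsGaussianRandomMeasure M m P) [IsProbabilityMeasure P] {ι : Type*}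
    (s : Finset ι) (c : ι → ℝ) (S : ι → Set E) (hS : ∀ i, MeasurableSet (S i))
    (hS' : ∀ i, m (S i) < ∞) :
    ∫ ω, (∑ i ∈ s, c i * M (S i) ω) ^ 2 ∂P
      = ∫ x, (∑ i ∈ s, c i * (S i).indicator (fun _ => 1) x) ^ 2 ∂m := by
  have e1 : ∀ ω, (∑ i ∈ s, c i * M (S i) ω) ^ 2
      = ∑ i ∈ s, ∑ j ∈ s, c i * c j * (M (S i) ω * M (S j) ω) := fun ω => by
    rw [sq, Finset.sum_mul_sum]
    exact Finset.sum_congr rfl fun i _ => Finset.sum_congr rfl fun j _ => by ring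
  have e2 : ∀ x, (∑ i ∈ s, c i * (S i).indicator (fun _ => (1 : ℝ)) x) ^ 2
      = ∑ i ∈ s, ∑ j ∈ s, c i * c j * (S i ∩ S j).indicator (fun _ => (1 : ℝ)) x := fun x => by
    rw [sq, Finset.sum_mul_sum]
    refine Finset.sum_congr rfl fun i _ => Finset.sum_congr rfl fun j _ => ?_
    rw [← Pi.one_def, Set.inter_indicator_one, Pi.mul_apply]
    ring
  have i1 : ∀ i j, Integrable (fun ω => M (S i) ω * M (S j) ω) P := fun i j =>
    (hM.memLp_two (hS i) (hS' i)).integrable_mul (hM.memLp_two (hS j) (hS' j))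
  have i2 : ∀ i j, Integrable ((S i ∩ S j).indicator (fun _ => (1 : ℝ))) m := fun i j =>
    (integrable_indicator_iff ((hS i).inter (hS j))).2 (integrableOn_const
      ((measure_mono Set.inter_subset_left).trans_lt (hS' i)).ne)
  simp_rw [e1, e2]
  rw [integral_finsetSum _ fun i _ => integrable_finsetSum _ fun j _ => (i1 i j).const_mul _,
    integral_finsetSum _ fun i _ => integrable_finsetSum _ fun j _ => (i2 i j).const_mul _]
  refine Finset.sum_congr rfl fun i _ => ?_
  rw [integral_finsetSum _ fun j _ => (i1 i j).const_mul _,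
    integral_finsetSum _ fun j _ => (i2 i j).const_mul _]
  refine Finset.sum_congr rfl fun j _ => ?_
  rw [integral_const_mul, integral_const_mul, hM.integral_mul_eq (hS i) (hS j) (hS' i) (hS' j),
    integral_indicator_const _ ((hS i).inter (hS j))]
  simp

end IsGaussianRandomMeasure

/-! ### The isometry, integrals of indicators, and a fourth moment bound -/

lemma eLpNorm_two_eq_of_integral_sq_eq {α β : Type*} [MeasurableSpace α] [MeasurableSpace β]
    {μ : Measure α} {ν : Measure β} {f : α → ℝ} {g : β → ℝ} (hf : MemLp f 2 μ) (hg : MemLp g 2 ν)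
    (h : ∫ x, f x ^ 2 ∂μ = ∫ x, g x ^ 2 ∂ν) : eLpNorm f 2 μ = eLpNorm g 2 ν := by
  rw [hf.eLpNorm_eq_integral_rpow_norm (by simp) (by simp),
    hg.eLpNorm_eq_integral_rpow_norm (by simp) (by simp)]
  simp [h]

namespace IsGaussianRandomMeasure

variable {E Ω : Type*} [MeasurableSpace E] [MeasurableSpace Ω] {M : Set E → Ω → ℝ}
  {m : Measure E} {P : Measure Ω} {A B : Set E}

lemma eLpNorm_simpleRandomIntegral_sub (hM : IsGaussianRandomMeasure M m P)
    [IsProbabilityMeasure P] (hA : MeasurableSet A) (hA' : m A < ∞) (φ : SimpleFunc E ℝ)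
    (hφ : MemLp φ 2 m) :
    MemLp (simpleRandomIntegral M φ) 2 P ∧
    eLpNorm (simpleRandomIntegral M φ - M A) 2 P
      = eLpNorm (fun x => φ x - A.indicator (fun _ => 1) x) 2 m := by
  classical
  -- The index `none` carries A with coefficient -1. The zero level set may have infinite measure,
  -- so ∅ replaces it; its coefficient is 0 anyway.
  let S : Option ℝ → Set E := fun o => o.elim A fun y => if y = 0 then ∅ else φ ⁻¹' {y}
  let c : Option ℝ → ℝ := fun o => o.elim (-1) id
  have hS : ∀ i, MeasurableSet (S i) := by
    rintro (_ | y)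
    · exact hA
    · simp only [S, Option.elim]
      split_ifs
      exacts [.empty, φ.measurableSet_fiber y]
  have hS' : ∀ i, m (S i) < ∞ := by
    rintro (_ | y)
    · exact hA'
    · simp only [S, Option.elim]
      split_ifs with h
      · simp
      · exact SimpleFunc.measure_preimage_lt_top_of_memLp (by simp) (by simp) φ hφ y h
  have e0 : simpleRandomIntegral M φ
      = fun ω => ∑ y ∈ φ.range, y * M (S (some y)) ω := by
    ext ω
    refine Finset.sum_congr rfl fun y _ => ?_
    by_cases hy : y = 0
    · simp [hy]
    · simp [S, hy]
  have e1 : (simpleRandomIntegral M φ - M A)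
      = fun ω => ∑ i ∈ Finset.insertNone φ.range, c i * M (S i) ω := by
    ext ω
    rw [Finset.sum_insertNone, Pi.sub_apply, e0]
    simp only [c, S, Option.elim, id]
    ring
  have e2 : (fun x => φ x - A.indicator (fun _ => 1) x)
      = fun x => ∑ i ∈ Finset.insertNone φ.range, c i * (S i).indicator (fun _ => 1) x := by
    ext x
    rw [Finset.sum_insertNone]
    simp only [c, S, Option.elim, id]
    rw [Finset.sum_eq_single_of_mem (φ x) (φ.mem_range_self x)]
    · by_cases hx : φ x = 0
      · simp [hx]
      · simp [hx]; ring
    · intro y _ hy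
      by_cases h : y = 0
      · simp [h]
      · simp [h, Ne.symm hy]
  have hl : MemLp (simpleRandomIntegral M φ) 2 P := by
    rw [e0]
    exact memLp_finsetSum _ fun y _ => (hM.memLp_two (hS _) (hS' _)).const_mul _
  refine ⟨hl, eLpNorm_two_eq_of_integral_sq_eq (hl.sub (hM.memLp_two hA hA'))
    (hφ.sub (memLp_indicator_const 2 hA 1 (.inr hA'.ne))) ?_⟩
  simp_rw [e1]
  rw [hM.integral_sum_sq _ _ _ hS hS']
  exact integral_congr_ae (.of_forall fun x => by simp only [← congrFun e2 x])

/-- By the isometry the integrals of the approximating simple functions converge to `M A` in L²,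
hence in probability, and limits in probability are almost surely unique. -/
lemma ae_eq_of_isRandomMeasureIntegral (hM : IsGaussianRandomMeasure M m P)
    [IsProbabilityMeasure P] (hA : MeasurableSet A) (hA' : m A < ∞) {Z : Ω → ℝ}
    (hZ : IsRandomMeasureIntegral M m P (A.indicator fun _ => 1) Z) : Z =ᵐ[P] M A := by
  obtain ⟨-, φ, hφ, h0, hlim⟩ := hZ
  refine tendstoInMeasure_ae_unique hlim (tendstoInMeasure_of_tendsto_eLpNorm (p := 2) (by simp)
    (fun n => (hM.eLpNorm_simpleRandomIntegral_sub hA hA' (φ n) (hφ n)).1.1)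
    (hM.memLp_two hA hA').1 ?_)
  simp_rw [fun n => (hM.eLpNorm_simpleRandomIntegral_sub hA hA' (φ n) (hφ n)).2]
  exact h0

lemma isRandomMeasureIntegral_of_ae_eq (hM : IsGaussianRandomMeasure M m P)
    [IsProbabilityMeasure P] (hA : MeasurableSet A) (hA' : m A < ∞) {Z : Ω → ℝ}
    (hZ : Z =ᵐ[P] M A) : IsRandomMeasureIntegral M m P (A.indicator fun _ => 1) Z := by
  have hl : MemLp (A.indicator fun _ => (1 : ℝ)) 2 m := memLp_indicator_const 2 hA 1 (.inr hA'.ne)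
  let φ : SimpleFunc E ℝ := SimpleFunc.piecewise A hA (SimpleFunc.const E 1) (SimpleFunc.const E 0)
  have hφ : (φ : E → ℝ) = A.indicator fun _ => 1 := by
    ext x
    simp [φ, Set.indicator, Set.piecewise]
  refine ⟨hl, fun _ => φ, fun _ => by rwa [hφ], ?_, ?_⟩
  · simp [hφ]
  · have := hM.eLpNorm_simpleRandomIntegral_sub hA hA' φ (by rwa [hφ])
    have h0 : eLpNorm (simpleRandomIntegral M φ - M A) 2 P = 0 := by
      rw [this.2, hφ]; simp
    rw [eLpNorm_eq_zero_iff (this.1.1.sub (hM.memLp_two hA hA').1) (by simp)] at h0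
    have h1 : simpleRandomIntegral M φ =ᵐ[P] Z := by
      filter_upwards [h0, hZ] with ω h1 h2
      rw [h2]
      exact sub_eq_zero.1 h1
    exact (tendstoInMeasure_of_tendsto_eLpNorm (p := 2) (f := fun _ => M A) (g := M A) (by simp)
      (fun n => (hM.memLp_two hA hA').1) (hM.memLp_two hA hA').1 (by simp)).congr
        (fun _ => hZ.symm.trans h1.symm) hZ.symm

/-- A fourth moment bound for the increments. -/
lemma measure_le_abs_sub_le (hM : IsGaussianRandomMeasure M m P) :
    ∃ C : ℝ≥0, ∀ A B : Set E, MeasurableSet A → MeasurableSet B → A ⊆ B → m B < ∞ → ∀ ε : ℝ, 0 < ε →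
      P {ω | ε ≤ |M B ω - M A ω|} ≤ C * ENNReal.ofReal ((m.real B - m.real A) ^ 2 / ε ^ 4) := by
  have hfin : ∫⁻ x, ENNReal.ofReal (x ^ 4) ∂(gaussianReal 0 1) < ∞ := by
    have h := (memLp_id_gaussianReal (μ := 0) (v := 1) 4).integrable_norm_pow (by simp)
    have := h.lintegral_lt_top
    simpa [Even.pow_abs (show Even 4 by decide)] using this
  refine ⟨(∫⁻ x, ENNReal.ofReal (x ^ 4) ∂(gaussianReal 0 1)).toNNReal, ?_⟩
  intro A B hA hB hAB hB' ε hε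
  rw [ENNReal.coe_toNNReal hfin.ne]
  have hD := hB.diff hA
  have hD' : m (B \ A) < ∞ := (measure_mono Set.sdiff_subset).trans_lt hB'
  have hA' : m A < ∞ := (measure_mono hAB).trans_lt hB'
  set v := m.real (B \ A) with hv
  have hvd : v = m.real B - m.real A := measureReal_sdiff hAB hA hB'.ne
  have hlaw := hM.hasLaw _ hD hD'
  have h1 : P {ω | ε ≤ |M B ω - M A ω|} = gaussianReal 0 (m (B \ A)).toNNReal {x | ε ≤ |x|} := by
    rw [← hlaw.measure_eq (p := fun x => ε ≤ |x|) (measurableSet_le (by fun_prop) (by fun_prop))]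
    refine measure_congr (eventuallyEq_set.2 ?_)
    filter_upwards [hM.diff_ae_eq hA hB hAB hB'] with ω h
    simp only [h]
  rw [h1]
  -- Scaling to the standard Gaussian leaves v² times one universal fourth moment, which serves as
  -- the constant for all A and B.
  have h2 : gaussianReal 0 (m (B \ A)).toNNReal = (gaussianReal 0 1).map (√v * ·) := by
    rw [gaussianReal_map_const_mul]
    congr 1
    · simp
    · ext; simp [hv, Measure.real]; rfl
  rw [h2, Measure.map_apply (by fun_prop) (measurableSet_le (by fun_prop) (by fun_prop)), ← hvd]
  have h3 : ∀ x : ℝ, ε ≤ |√v * x| → ENNReal.ofReal (ε ^ 4) ≤ ENNReal.ofReal (v ^ 2 * x ^ 4) := by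
    intro x hx
    refine ENNReal.ofReal_le_ofReal ?_
    have : v ^ 2 * x ^ 4 = |√v * x| ^ 4 := by
      rw [Even.pow_abs (by decide), mul_pow]
      congr 1
      rw [show 4 = 2 * 2 from rfl, pow_mul, Real.sq_sqrt measureReal_nonneg]
    rw [this]
    gcongr
  have hε4 : ENNReal.ofReal (ε ^ 4) ≠ 0 := by simpa using by positivity
  calc gaussianReal 0 1 ((√v * ·) ⁻¹' {x | ε ≤ |x|})
      ≤ gaussianReal 0 1 {x | ENNReal.ofReal (ε ^ 4) ≤ ENNReal.ofReal (v ^ 2 * x ^ 4)} :=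
        measure_mono h3
    _ ≤ (∫⁻ x, ENNReal.ofReal (v ^ 2 * x ^ 4) ∂(gaussianReal 0 1)) / ENNReal.ofReal (ε ^ 4) :=
        meas_ge_le_lintegral_div (by fun_prop) hε4 (by simp)
    _ = _ := by
        simp_rw [ENNReal.ofReal_mul (sq_nonneg v)]
        rw [lintegral_const_mul _ (by fun_prop), ENNReal.ofReal_div_of_pos (by positivity),
          mul_comm, mul_div_assoc]

end IsGaussianRandomMeasure

/-! ### Brownian motion on the half-line -/

section Interval

variable {Ω : Type*} [MeasurableSpace Ω] {M : Set ℝ → Ω → ℝ} {P : Measure Ω}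

lemma volume_uIcc_zero_lt_top (y : ℝ) : volume (Set.uIcc 0 y) < ∞ :=
  isCompact_uIcc.measure_lt_top

lemma volume_real_uIcc_zero (y : ℝ) : (volume : Measure ℝ).real (Set.uIcc 0 y) = |y| := by
  simp [Measure.real, Real.volume_interval]

/-- Increments are almost surely the values of M on the half-open intervals (s, t], which are
disjoint for successive times. -/
lemma IsGaussianRandomMeasure.isPreBrownianReal (hM : IsGaussianRandomMeasure M volume P) :
    IsPreBrownianReal (fun (t : ℝ≥0) => M (Set.uIcc 0 (t : ℝ))) P := by
  refine HasIndepIncrements.isPreBrownianReal_of_hasLaw (fun t => ?_) fun n t ht => ?_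
  · have h := hM.hasLaw _ measurableSet_uIcc (volume_uIcc_zero_lt_top t)
    rw [Real.volume_interval] at h
    simpa using h
  · have key := hM.indep n (fun i => Set.Ioc (t i.castSucc : ℝ) (t i.succ)) (by simp) (by simp) ?_
    · refine key.congr fun i => ?_
      have hle : t i.castSucc ≤ t i.succ := ht (Fin.castSucc_lt_succ).le
      have hle' : (t i.castSucc : ℝ) ≤ t i.succ := by exact_mod_cast hle
      have := hM.diff_ae_eq (A := Set.uIcc 0 (t i.castSucc : ℝ)) (B := Set.uIcc 0 (t i.succ : ℝ))
        measurableSet_uIcc measurableSet_uIcc ?_ (volume_uIcc_zero_lt_top _)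
      · filter_upwards [this] with ω h
        rw [h]
        congr 1
        ext x
        simp only [Set.uIcc_of_le (NNReal.coe_nonneg _), Set.mem_Ioc, Set.mem_sdiff, Set.mem_Icc,
          not_and, not_le]
        constructor
        · rintro ⟨h1, h2⟩
          exact ⟨⟨(NNReal.coe_nonneg _).trans h1.le, h2⟩, fun _ => h1⟩
        · rintro ⟨⟨h1, h2⟩, h3⟩
          exact ⟨h3 h1, h2⟩
      · rw [Set.uIcc_of_le (NNReal.coe_nonneg _), Set.uIcc_of_le (NNReal.coe_nonneg _)]
        exact Set.Icc_subset_Icc_right hle'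
    · have aux : ∀ i j : Fin n, i < j → Disjoint (Set.Ioc (t i.castSucc : ℝ) (t i.succ))
          (Set.Ioc (t j.castSucc : ℝ) (t j.succ)) := fun i j hij => by
        refine Set.disjoint_left.2 fun x hx hx' => ?_
        have : t i.succ ≤ t j.castSucc := ht (Fin.succ_le_castSucc_iff.2 hij)
        have : (t i.succ : ℝ) ≤ t j.castSucc := by exact_mod_cast this
        exact absurd (hx'.1.trans_le hx.2) this.not_gt
      intro i j hij
      rcases lt_or_gt_of_ne hij with h | h
      exacts [aux i j h, (aux j i h).symm]

end Interval

/-! ### Dyadic chaining and continuous measurable versions -/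

/-- The largest dyadic number of level `n` below `x`. -/
noncomputable def dyadicFloor (n : ℕ) (x : ℝ) : ℝ := (⌊2 ^ n * x⌋ : ℝ) / 2 ^ n

lemma dyadicFloor_le (n : ℕ) (x : ℝ) : dyadicFloor n x ≤ x := by
  rw [dyadicFloor, div_le_iff₀ (by positivity), mul_comm x]
  exact Int.floor_le _

lemma sub_dyadicFloor_le (n : ℕ) (x : ℝ) : x - dyadicFloor n x ≤ 1 / 2 ^ n := by
  rw [dyadicFloor, sub_le_iff_le_add, ← add_div, le_div_iff₀ (by positivity), mul_comm x, add_comm]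
  exact (Int.lt_floor_add_one _).le

lemma dyadicFloor_nonneg (n : ℕ) {x : ℝ} (hx : 0 ≤ x) : 0 ≤ dyadicFloor n x :=
  div_nonneg (by exact_mod_cast Int.floor_nonneg.2 (by positivity)) (by positivity)

lemma mul_dyadicFloor_nonneg (n : ℕ) (x : ℝ) : 0 ≤ x * dyadicFloor n x := by
  rcases le_total 0 x with h | h
  · exact mul_nonneg h (dyadicFloor_nonneg n h)
  · exact mul_nonneg_of_nonpos_of_nonpos h ((dyadicFloor_le n x).trans h)

lemma abs_floor_two_pow_mul_le {N n : ℕ} {x : ℝ} (hx : |x| ≤ N) :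
    |(⌊2 ^ n * x⌋ : ℝ)| ≤ ((N + 1 : ℕ) : ℝ) * 2 ^ n := by
  have h1 := Int.floor_le (2 ^ n * x)
  have h2 := Int.lt_floor_add_one (2 ^ n * x)
  have h3 : (1 : ℝ) ≤ 2 ^ n := one_le_pow₀ (by norm_num)
  have h4 : |2 ^ n * x| ≤ 2 ^ n * N := by
    rw [abs_mul, abs_of_pos (by positivity : (0 : ℝ) < 2 ^ n)]
    gcongr
  rw [abs_le] at h4 ⊢
  push_cast
  constructor <;> linarith

/-- A function on the dyadic numbers whose increments over neighbours of level `n` are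
at most `r ^ n`, locally uniformly and for large `n`, extends to a continuous function. -/
lemma exists_continuous_tendsto_dyadicFloor {F : ℝ → ℝ} {r : ℝ} (hr0 : 0 < r) (hr1 : r < 1)
    (hF : ∀ N : ℕ, ∃ n₀ : ℕ, ∀ n ≥ n₀, ∀ k : ℤ, |(k : ℝ)| ≤ N * 2 ^ n →
      |F ((k + 1) / 2 ^ n) - F (k / 2 ^ n)| ≤ r ^ n) :
    ∃ g : ℝ → ℝ, Continuous g ∧ ∀ x, Tendsto (fun n => F (dyadicFloor n x)) atTop (𝓝 (g x)) := by
  have step : ∀ N : ℕ, ∃ n₀ : ℕ, ∀ n ≥ n₀, ∀ x : ℝ, |x| ≤ N →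
      dist (F (dyadicFloor n x)) (F (dyadicFloor (n + 1) x)) ≤ r ^ n := by
    intro N
    -- Rounding down may leave [-N, N], hence `N + 1`.
    obtain ⟨n₀, hn₀⟩ := hF (N + 1)
    refine ⟨n₀, fun n hn x hx => ?_⟩
    set k := ⌊2 ^ n * x⌋ with hk
    have hkb : |(k : ℝ)| ≤ ((N + 1 : ℕ) : ℝ) * 2 ^ n := abs_floor_two_pow_mul_le hx
    have h1 := Int.floor_le (2 ^ n * x)
    have h2 := Int.lt_floor_add_one (2 ^ n * x)
    rw [← hk] at h1 h2
    have e0 : dyadicFloor n x = ((2 * k : ℤ) : ℝ) / 2 ^ (n + 1) := by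
      rw [dyadicFloor, ← hk, pow_succ]; push_cast; field_simp
    -- Refining the level keeps the floor or moves it to its right neighbour of level n + 1, so one
    -- controlled increment bounds the step.
    have hcase : ⌊2 ^ (n + 1) * x⌋ = 2 * k ∨ ⌊2 ^ (n + 1) * x⌋ = 2 * k + 1 := by
      have h3 : 2 * k ≤ ⌊2 ^ (n + 1) * x⌋ := by
        rw [Int.le_floor]; push_cast; rw [pow_succ]; linarith
      have h4 : ⌊2 ^ (n + 1) * x⌋ < 2 * k + 2 := by
        rw [Int.floor_lt]; push_cast; rw [pow_succ]; linarith
      omega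
    rcases hcase with h | h
    · rw [e0, show dyadicFloor (n + 1) x = ((2 * k : ℤ) : ℝ) / 2 ^ (n + 1) by rw [dyadicFloor, h]]
      simpa using by positivity
    · rw [e0, show dyadicFloor (n + 1) x = (((2 * k : ℤ) : ℝ) + 1) / 2 ^ (n + 1) by
        rw [dyadicFloor, h]; push_cast; rfl, dist_comm, Real.dist_eq]
      refine (hn₀ (n + 1) (by omega) (2 * k) ?_).trans ?_
      · push_cast at hkb ⊢
        rw [abs_mul, pow_succ, abs_two]; linarith
      · exact pow_le_pow_of_le_one hr0.le hr1.le (by omega)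
  have tail : ∀ N : ℕ, ∃ n₀ : ℕ, ∀ x : ℝ, |x| ≤ N → ∃ a : ℝ,
      Tendsto (fun n => F (dyadicFloor n x)) atTop (𝓝 a) ∧
      ∀ n ≥ n₀, dist (F (dyadicFloor n x)) a ≤ r ^ n / (1 - r) := by
    intro N
    obtain ⟨n₀, hn₀⟩ := step N
    refine ⟨n₀, fun x hx => ?_⟩
    have hu : ∀ m, dist (F (dyadicFloor (m + n₀) x)) (F (dyadicFloor (m + 1 + n₀) x))
        ≤ r ^ n₀ * r ^ m := fun m => by
      rw [← pow_add, add_comm n₀, show m + 1 + n₀ = m + n₀ + 1 by ring]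
      exact hn₀ (m + n₀) (by omega) x hx
    obtain ⟨a, ha⟩ := cauchySeq_tendsto_of_complete (cauchySeq_of_le_geometric r _ hr1 hu)
    refine ⟨a, (tendsto_add_atTop_iff_nat (f := fun n => F (dyadicFloor n x)) n₀).1 ha,
      fun n hn => ?_⟩
    obtain ⟨m, rfl⟩ := Nat.exists_eq_add_of_le' hn
    have := dist_le_of_le_geometric_of_tendsto r _ hr1 hu ha m
    rwa [← pow_add, add_comm n₀] at this
  have lim : ∀ x, ∃ a : ℝ, Tendsto (fun n => F (dyadicFloor n x)) atTop (𝓝 a) := fun x => by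
    obtain ⟨N, hN⟩ := exists_nat_ge |x|
    obtain ⟨n₀, h⟩ := tail N
    exact (h x hN).imp fun _ h => h.1
  choose g hg using lim
  refine ⟨g, continuous_iff_continuousAt.2 fun x => Metric.continuousAt_iff.2 fun ε hε => ?_, hg⟩
  obtain ⟨N, hN⟩ := exists_nat_ge (|x| + 1)
  obtain ⟨n₁, hn₁⟩ := tail N
  obtain ⟨n₂, hn₂⟩ := hF (N + 1)
  have hsmall : Tendsto (fun n : ℕ => r ^ n * (1 + 2 / (1 - r))) atTop (𝓝 0) := by
    simpa using (tendsto_pow_atTop_nhds_zero_of_lt_one hr0.le hr1).mul_const _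
  obtain ⟨n, hnε, hn⟩ := ((hsmall.eventually_lt_const hε).and
    (eventually_ge_atTop (max n₁ n₂))).exists
  -- Points closer than 2^{-n} have equal or adjacent floors of level n; this costs r^n, and the two
  -- geometric tails cost r^n / (1 - r) each.
  refine ⟨1 / 2 ^ n, by positivity, fun {y} hy => ?_⟩
  have h2n : (1 : ℝ) ≤ 2 ^ n := one_le_pow₀ (by norm_num)
  have hle1 : (1 : ℝ) / 2 ^ n ≤ 1 := (div_le_one (by positivity)).2 h2n
  have hxN : |x| ≤ N := by linarith
  have hyN : |y| ≤ N := by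
    have := abs_sub_abs_le_abs_sub y x
    rw [Real.dist_eq] at hy
    linarith
  have tb : ∀ z : ℝ, |z| ≤ N → dist (F (dyadicFloor n z)) (g z) ≤ r ^ n / (1 - r) := fun z hz => by
    obtain ⟨a, ha, hb⟩ := hn₁ z hz
    rw [tendsto_nhds_unique (hg z) ha]
    exact hb n (by omega)
  have key : ∀ u v : ℝ, |u| ≤ N → u ≤ v → v - u < 1 / 2 ^ n →
      dist (F (dyadicFloor n u)) (F (dyadicFloor n v)) ≤ r ^ n := by
    intro u v hu huv hd
    have h1 := Int.floor_le (2 ^ n * u)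
    have h2 := Int.lt_floor_add_one (2 ^ n * u)
    set k := ⌊2 ^ n * u⌋ with hk
    have hvu : 2 ^ n * v - 2 ^ n * u < 1 := by
      rw [lt_div_iff₀ (by positivity)] at hd; linarith
    have huv' : (2 : ℝ) ^ n * u ≤ 2 ^ n * v := by gcongr
    have hcase : ⌊2 ^ n * v⌋ = k ∨ ⌊2 ^ n * v⌋ = k + 1 := by
      have h3 : k ≤ ⌊2 ^ n * v⌋ := Int.floor_le_floor huv'
      have h4 : ⌊2 ^ n * v⌋ < k + 2 := by
        rw [Int.floor_lt]; push_cast; linarith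
      omega
    rcases hcase with h | h
    · rw [dyadicFloor, dyadicFloor, h, ← hk]
      simpa using by positivity
    · rw [dyadicFloor, dyadicFloor, h, ← hk, dist_comm, Real.dist_eq]
      push_cast
      exact hn₂ n (by omega) k (abs_floor_two_pow_mul_le hu)
  have key' : dist (F (dyadicFloor n y)) (F (dyadicFloor n x)) ≤ r ^ n := by
    rw [Real.dist_eq, abs_lt] at hy
    rcases le_total y x with h | h
    · exact key y x hyN h (by linarith)
    · rw [dist_comm]; exact key x y hxN h (by linarith)
  calc dist (g y) (g x)
      ≤ dist (g y) (F (dyadicFloor n y)) + dist (F (dyadicFloor n y)) (F (dyadicFloor n x))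
        + dist (F (dyadicFloor n x)) (g x) := dist_triangle4 _ _ _ _
    _ ≤ r ^ n / (1 - r) + r ^ n + r ^ n / (1 - r) := by
        rw [dist_comm (g y)]
        gcongr
        exacts [tb y hyN, tb x hxN]
    _ = r ^ n * (1 + 2 / (1 - r)) := by ring
    _ < ε := hnε

/-- A process with almost surely continuous paths is indistinguishable from a measurable process
all of whose paths are continuous. -/
lemma exists_continuous_measurable_of_ae {T Ω : Type*} [TopologicalSpace T]
    [FirstCountableTopology T] [TopologicalSpace.SeparableSpace T] [Nonempty T] [MeasurableSpace Ω]
    {P : Measure Ω} {X : T → Ω → ℝ} (hX : ∀ t, AEMeasurable (X t) P)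
    (hc : ∀ᵐ ω ∂P, Continuous fun t => X t ω) :
    ∃ X' : T → Ω → ℝ, (∀ t, Measurable (X' t)) ∧ (∀ ω, Continuous fun t => X' t ω) ∧
      ∀ᵐ ω ∂P, ∀ t, X t ω = X' t ω := by
  classical
  have h : ∀ᵐ ω ∂P, Continuous (fun t => X t ω) ∧
      ∀ k, X (TopologicalSpace.denseSeq T k) ω = (hX (TopologicalSpace.denseSeq T k)).mk _ ω :=
    hc.and (ae_all_iff.2 fun k => (hX _).ae_eq_mk)
  obtain ⟨N, hN, hNm, hN0⟩ := exists_measurable_superset_of_null h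
  have hN' : ∀ ω ∉ N, Continuous (fun t => X t ω) ∧
      ∀ k, X (TopologicalSpace.denseSeq T k) ω = (hX (TopologicalSpace.denseSeq T k)).mk _ ω := fun ω hω => by
    by_contra hcon
    exact hω (hN hcon)
  -- Off `N` the values at dense points are those of measurable representatives, and by continuity
  -- every other value is a limit of these.
  refine ⟨fun t => Nᶜ.indicator (X t), fun t => ?_, fun ω => ?_, ?_⟩
  · have hcont : ∀ ω, Continuous fun t => Nᶜ.indicator (X t) ω := fun ω => by
      by_cases hω : ω ∈ N
      · simp [hω, continuous_const]
      · simpa [hω] using (hN' ω hω).1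
    have hd : t ∈ closure (Set.range (TopologicalSpace.denseSeq T)) := TopologicalSpace.denseRange_denseSeq T t
    obtain ⟨u, hu, hut⟩ := mem_closure_iff_seq_limit.1 hd
    refine measurable_of_tendsto_metrizable (f := fun n => Nᶜ.indicator (X (u n))) (fun n => ?_)
      (tendsto_pi_nhds.2 fun ω => ((hcont ω).tendsto t).comp hut)
    obtain ⟨k, hk⟩ := hu n
    rw [← hk]
    have : Nᶜ.indicator (X (TopologicalSpace.denseSeq T k)) = Nᶜ.indicator ((hX (TopologicalSpace.denseSeq T k)).mk _) :=
      Set.indicator_congr fun ω hω => (hN' ω hω).2 k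
    rw [this]
    exact (hX _).measurable_mk.indicator hNm.compl
  · by_cases hω : ω ∈ N
    · simp [hω, continuous_const]
    · simpa [hω] using (hN' ω hω).1
  · filter_upwards [measure_eq_zero_iff_ae_notMem.1 hN0] with ω hω t
    simp [hω]

/-! ### The continuous version on the whole line -/

namespace IsGaussianRandomMeasure

variable {Ω : Type*} [MeasurableSpace Ω] {M : Set ℝ → Ω → ℝ} {P : Measure Ω}

/-- The sign condition makes the two intervals nested, with a difference of measure |y - x|. It
holds for neighbouring dyadics and for a point and its dyadic floor, which is all that chaining
needs. -/
lemma measure_le_abs_sub_uIcc_le (hM : IsGaussianRandomMeasure M volume P) :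
    ∃ C : ℝ≥0, ∀ x y : ℝ, 0 ≤ x * y → ∀ ε : ℝ, 0 < ε →
      P {ω | ε ≤ |M (Set.uIcc 0 y) ω - M (Set.uIcc 0 x) ω|}
        ≤ C * ENNReal.ofReal ((y - x) ^ 2 / ε ^ 4) := by
  obtain ⟨C, hC⟩ := hM.measure_le_abs_sub_le
  refine ⟨C, fun x y hxy ε hε => ?_⟩
  wlog h : |x| ≤ |y| generalizing x y
  · have := this y x (by rwa [mul_comm]) (le_of_not_ge h)
    simpa only [abs_sub_comm, ← neg_sub y x, neg_sq] using this
  have hsub : Set.uIcc 0 x ⊆ Set.uIcc 0 y := by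
    rw [Set.uIcc_subset_uIcc_iff_mem]
    refine ⟨Set.left_mem_uIcc, ?_⟩
    rw [Set.mem_uIcc]
    rcases le_total 0 y with hy | hy
    · rw [abs_of_nonneg hy, abs_le] at h
      rcases hy.eq_or_lt with rfl | hy
      · left; constructor <;> linarith
      · left; exact ⟨nonneg_of_mul_nonneg_left hxy hy, h.2⟩
    · rw [abs_of_nonpos hy, abs_le] at h
      rcases hy.eq_or_lt with rfl | hy
      · right; constructor <;> linarith
      · right; exact ⟨by linarith, nonpos_of_mul_nonneg_left hxy hy⟩
  refine (hC _ _ measurableSet_uIcc measurableSet_uIcc hsub (volume_uIcc_zero_lt_top y) ε hε).trans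
    (le_of_eq ?_)
  rw [volume_real_uIcc_zero, volume_real_uIcc_zero, sub_sq, sub_sq, sq_abs, sq_abs, mul_assoc,
    ← abs_mul, mul_comm y x, abs_of_nonneg hxy]
  ring_nf

lemma aemeasurable_uIcc (hM : IsGaussianRandomMeasure M volume P) (x : ℝ) :
    AEMeasurable (M (Set.uIcc 0 x)) P :=
  (hM.hasLaw _ measurableSet_uIcc (volume_uIcc_zero_lt_top x)).aemeasurable

/-- Borel–Cantelli: level n has about 2N · 2^n increments, each exceeding (9/10)^n with probability
at most C (2^{-n})² / (9/10)^{4n}. The sum converges because 2 · (9/10)^4 > 1. -/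
lemma ae_dyadic_increment_le (hM : IsGaussianRandomMeasure M volume P) :
    ∀ᵐ ω ∂P, ∀ N : ℕ, ∃ n₀ : ℕ, ∀ n ≥ n₀, ∀ k : ℤ, |(k : ℝ)| ≤ N * 2 ^ n →
      |M (Set.uIcc 0 ((k + 1) / 2 ^ n)) ω - M (Set.uIcc 0 (k / 2 ^ n)) ω| ≤ (9 / 10 : ℝ) ^ n := by
  obtain ⟨C, hC⟩ := hM.measure_le_abs_sub_uIcc_le
  refine ae_all_iff.2 fun N => ?_
  let K : ℕ → Finset ℤ := fun n => Finset.Icc (-(N * 2 ^ n : ℕ) : ℤ) (N * 2 ^ n : ℕ)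
  let S : ℕ → Set Ω := fun n => ⋃ k ∈ K n, {ω | (9 / 10 : ℝ) ^ n ≤
    |M (Set.uIcc 0 (((k : ℝ) + 1) / 2 ^ n)) ω - M (Set.uIcc 0 ((k : ℝ) / 2 ^ n)) ω|}
  have hcard : ∀ n, (K n).card = 2 * (N * 2 ^ n) + 1 := fun n => by
    simp only [K, Int.card_Icc]
    omega
  have hS : ∀ n, P (S n) ≤ C * ENNReal.ofReal (3 * (N + 1) * (1 / (2 * (9 / 10) ^ 4)) ^ n) := by
    intro n
    calc P (S n) ≤ ∑ k ∈ K n, P {ω | (9 / 10 : ℝ) ^ n ≤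
          |M (Set.uIcc 0 (((k : ℝ) + 1) / 2 ^ n)) ω - M (Set.uIcc 0 ((k : ℝ) / 2 ^ n)) ω|} :=
          measure_biUnion_finset_le _ _
      _ ≤ ∑ k ∈ K n, C * ENNReal.ofReal ((1 / 2 ^ n) ^ 2 / ((9 / 10) ^ n) ^ 4) := by
          refine Finset.sum_le_sum fun k _ => ?_
          refine (hC _ _ ?_ _ (by positivity)).trans (le_of_eq ?_)
          · rw [div_mul_div_comm]
            have : 0 ≤ k * (k + 1) := by
              rcases le_or_gt 0 k with h | h
              · positivity
              · exact mul_nonneg_of_nonpos_of_nonpos h.le (by omega)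
            have : (0 : ℝ) ≤ k * (k + 1) := by exact_mod_cast this
            positivity
          · rw [← sub_div]; simp
      _ = C * ENNReal.ofReal ((2 * (N * 2 ^ n) + 1) * ((1 / 2 ^ n) ^ 2 / ((9 / 10) ^ n) ^ 4)) := by
          rw [Finset.sum_const, hcard, nsmul_eq_mul, ENNReal.ofReal_mul (by positivity), mul_left_comm]
          congr 2
          rw [← ENNReal.ofReal_natCast]
          push_cast; rfl
      _ ≤ _ := by
          refine mul_le_mul_of_nonneg_left (ENNReal.ofReal_le_ofReal ?_) zero_le
          have h0 : (1 / (2 * (9 / 10) ^ 4) : ℝ) ^ n = 1 / (2 ^ n * ((9 / 10) ^ n) ^ 4) := by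
            rw [one_div_pow, mul_pow, ← pow_mul, ← pow_mul, mul_comm 4 n]
          rw [h0]
          have h1 : (1 : ℝ) ≤ 2 ^ n := one_le_pow₀ (by norm_num)
          have h2 : (2 * (N * 2 ^ n) + 1 : ℝ) ≤ 3 * (N + 1) * 2 ^ n := by
            have : (0 : ℝ) ≤ N * 2 ^ n := by positivity
            nlinarith
          calc _ ≤ (3 * (N + 1) * 2 ^ n) * ((1 / 2 ^ n) ^ 2 / ((9 / 10 : ℝ) ^ n) ^ 4) := by
                gcongr
            _ = _ := by field_simp
  have hsum : ∑' n, P (S n) ≠ ∞ := by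
    refine ne_top_of_le_ne_top ?_ (ENNReal.tsum_le_tsum hS)
    rw [ENNReal.tsum_mul_left]
    refine ENNReal.mul_ne_top (by simp) ?_
    refine (Summable.tsum_ofReal_lt_top ?_).ne
    exact (summable_geometric_of_lt_one (by norm_num) (by norm_num)).mul_left _
  filter_upwards [ae_eventually_notMem hsum] with ω hω
  obtain ⟨n₀, hn₀⟩ := eventually_atTop.1 hω
  refine ⟨n₀, fun n hn k hk => ?_⟩
  have := hn₀ n hn
  simp only [S, Set.mem_iUnion, not_exists] at this
  refine (not_le.1 (this k ?_)).le
  rw [Finset.mem_Icc, ← abs_le]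
  exact_mod_cast hk

lemma tendstoInMeasure_dyadicFloor (hM : IsGaussianRandomMeasure M volume P) (x : ℝ) :
    TendstoInMeasure P (fun n => M (Set.uIcc 0 (dyadicFloor n x))) atTop (M (Set.uIcc 0 x)) := by
  obtain ⟨C, hC⟩ := hM.measure_le_abs_sub_uIcc_le
  rw [tendstoInMeasure_iff_norm]
  intro ε hε
  refine tendsto_of_tendsto_of_tendsto_of_le_of_le tendsto_const_nhds
    (h := fun n : ℕ => (C : ℝ≥0∞) * ENNReal.ofReal ((1 / 2 ^ n) ^ 2 / ε ^ 4)) ?_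
    (fun _ => zero_le) fun n => ?_
  · have h1 : Tendsto (fun n : ℕ => ((1 : ℝ) / 2 ^ n) ^ 2 / ε ^ 4) atTop (𝓝 0) := by
      have := tendsto_pow_atTop_nhds_zero_of_lt_one (r := (1 / 2 : ℝ)) (by norm_num) (by norm_num)
      simpa [one_div_pow] using (this.pow 2).div_const (ε ^ 4)
    have h2 := ENNReal.Tendsto.const_mul (a := (C : ℝ≥0∞)) (ENNReal.tendsto_ofReal h1)
      (.inr ENNReal.coe_ne_top)
    simpa using h2
  · refine (hC x (dyadicFloor n x) (mul_dyadicFloor_nonneg n x) ε hε).trans ?_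
    refine mul_le_mul_of_nonneg_left (ENNReal.ofReal_le_ofReal ?_) zero_le
    gcongr ?_ / _
    rw [← neg_sub, neg_sq]
    exact pow_le_pow_left₀ (sub_nonneg.2 (dyadicFloor_le n x)) (sub_dyadicFloor_le n x) 2

/-- The two-sided Brownian motion driven by a Gaussian random measure on the line. -/
lemma exists_continuous_version (hM : IsGaussianRandomMeasure M volume P)
    [IsProbabilityMeasure P] :
    ∃ B : ℝ → Ω → ℝ, (∀ x, Measurable (B x)) ∧ (∀ ω, Continuous fun x => B x ω) ∧
      ∀ x, B x =ᵐ[P] M (Set.uIcc 0 x) := by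
  classical
  have h1 : ∀ᵐ ω ∂P, ∃ g : ℝ → ℝ, Continuous g ∧
      ∀ x, Tendsto (fun n => M (Set.uIcc 0 (dyadicFloor n x)) ω) atTop (𝓝 (g x)) := by
    filter_upwards [hM.ae_dyadic_increment_le] with ω hω
    exact exists_continuous_tendsto_dyadicFloor (F := fun x => M (Set.uIcc 0 x) ω)
      (by norm_num) (by norm_num) hω
  have h2 : ∃ X : ℝ → Ω → ℝ, ∀ᵐ ω ∂P, Continuous (fun x => X x ω) ∧
      ∀ x, Tendsto (fun n => M (Set.uIcc 0 (dyadicFloor n x)) ω) atTop (𝓝 (X x ω)) := by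
    refine ⟨fun x ω => if h : ∃ g : ℝ → ℝ, Continuous g ∧
      ∀ x, Tendsto (fun n => M (Set.uIcc 0 (dyadicFloor n x)) ω) atTop (𝓝 (g x))
      then h.choose x else 0, ?_⟩
    filter_upwards [h1] with ω hω
    simpa only [hω, dite_true] using hω.choose_spec
  obtain ⟨X, hX⟩ := h2
  -- The almost sure limit and the limit in probability coincide. This also supplies the
  -- measurability that the pathwise choice of a limit function does not give.
  have hXM : ∀ x, X x =ᵐ[P] M (Set.uIcc 0 x) := fun x =>
    tendstoInMeasure_ae_unique (tendstoInMeasure_of_tendsto_ae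
      (fun n => (hM.aemeasurable_uIcc _).aestronglyMeasurable)
      (hX.mono fun ω h => h.2 x)) (hM.tendstoInMeasure_dyadicFloor x)
  obtain ⟨B, hB1, hB2, hB3⟩ := exists_continuous_measurable_of_ae
    (fun x => (hM.aemeasurable_uIcc x).congr (hXM x).symm) (hX.mono fun ω h => h.1)
  refine ⟨B, hB1, hB2, fun x => ?_⟩
  filter_upwards [hB3, hXM x] with ω h h'
  rw [← h x, h']

end IsGaussianRandomMeasure

/-! ### Exponentials of weakly correlated Gaussian variables -/

lemma ProbabilityTheory.HasGaussianLaw.integrable_exp {Ω : Type*} [MeasurableSpace Ω]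
    {P : Measure Ω} {Z : Ω → ℝ} (hZ : HasGaussianLaw Z P) :
    Integrable (fun ω => Real.exp (Z ω)) P := by
  have h := integrable_exp_mul_gaussianReal (μ := P[Z]) (v := Var[Z; P].toNNReal) 1
  rw [← hZ.map_eq_gaussianReal, integrable_map_measure (by fun_prop) hZ.aemeasurable] at h
  simpa [Function.comp_def] using h

lemma ProbabilityTheory.HasGaussianLaw.integral_exp {Ω : Type*} [MeasurableSpace Ω]
    {P : Measure Ω} {Z : Ω → ℝ} (hZ : HasGaussianLaw Z P) (h0 : P[Z] = 0) :
    ∫ ω, Real.exp (Z ω) ∂P = Real.exp (Var[Z; P] / 2) := by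
  have h := mgf_gaussianReal hZ.map_eq_gaussianReal 1
  simpa [mgf, h0, Real.coe_toNNReal _ (variance_nonneg Z P)] using h

section Exponentials

variable {Ω : Type*} [MeasurableSpace Ω] {P : Measure Ω} [IsProbabilityMeasure P]

/-- The second moment of the deviation of the average of exponentials of weakly correlated standard
Gaussian variables. -/
lemma integral_sum_exp_sub_sq_le {X : ℕ → Ω → ℝ} {η : ℝ} (hη : 0 ≤ η)
    (hX : IsGaussianProcess X P)
    (h0 : ∀ k, P[X k] = 0) (h1 : ∀ k, Var[X k; P] = 1)
    (hc : ∀ j k, j ≠ k → cov[X j, X k; P] ≤ η) (n : ℕ) :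
    Integrable (fun ω => (∑ k ∈ Finset.range n, (Real.exp (X k ω) - Real.exp (1 / 2))) ^ 2) P ∧
    ∫ ω, (∑ k ∈ Finset.range n, (Real.exp (X k ω) - Real.exp (1 / 2))) ^ 2 ∂P
      ≤ n * (Real.exp 2 - Real.exp 1) + n ^ 2 * (Real.exp (1 + η) - Real.exp 1) := by
  set a := Real.exp (1 / 2) with ha
  have haa : a * a = Real.exp 1 := by rw [ha, ← Real.exp_add]; norm_num
  have hl : ∀ k, MemLp (X k) 2 P := fun k => (hX.hasGaussianLaw_eval k).memLp_two
  have hi1 : ∀ k, Integrable (fun ω => Real.exp (X k ω)) P := fun k =>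
    (hX.hasGaussianLaw_eval k).integrable_exp
  have he1 : ∀ k, ∫ ω, Real.exp (X k ω) ∂P = a := fun k => by
    rw [(hX.hasGaussianLaw_eval k).integral_exp (h0 k), h1]
  have hi2 : ∀ j k, Integrable (fun ω => Real.exp ((X j + X k) ω)) P := fun j k =>
    (hX.hasGaussianLaw_add (s := j) (t := k)).integrable_exp
  have he2 : ∀ j k, ∫ ω, Real.exp ((X j + X k) ω) ∂P = Real.exp (1 + cov[X j, X k; P]) := by
    intro j k
    have hm : P[X j + X k] = 0 := by
      simp only [Pi.add_apply]
      rw [integral_add ((hl j).integrable (by simp)) ((hl k).integrable (by simp)), h0, h0, add_zero]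
    rw [(hX.hasGaussianLaw_add (s := j) (t := k)).integral_exp hm, variance_add (hl j) (hl k),
      h1, h1]
    congr 1; ring
  have hexp : ∀ j k ω, (Real.exp (X j ω) - a) * (Real.exp (X k ω) - a)
      = Real.exp ((X j + X k) ω) - a * Real.exp (X j ω) - a * Real.exp (X k ω) + a * a := by
    intro j k ω
    rw [Pi.add_apply, Real.exp_add]; ring
  have hi3 : ∀ j k, Integrable (fun ω => (Real.exp (X j ω) - a) * (Real.exp (X k ω) - a)) P := by
    intro j k
    simp_rw [hexp]
    exact (((hi2 j k).sub ((hi1 j).const_mul a)).sub ((hi1 k).const_mul a)).add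
      (integrable_const _)
  have he3 : ∀ j k, ∫ ω, (Real.exp (X j ω) - a) * (Real.exp (X k ω) - a) ∂P
      = Real.exp (1 + cov[X j, X k; P]) - Real.exp 1 := by
    intro j k
    simp_rw [hexp]
    have i1 : Integrable (fun ω => Real.exp ((X j + X k) ω) - a * Real.exp (X j ω)) P :=
      (hi2 j k).sub ((hi1 j).const_mul a)
    have i2 : Integrable (fun ω => Real.exp ((X j + X k) ω) - a * Real.exp (X j ω)
        - a * Real.exp (X k ω)) P := i1.sub ((hi1 k).const_mul a)
    rw [integral_add i2 (integrable_const _), integral_sub i1 ((hi1 k).const_mul a), integral_sub (hi2 j k) ((hi1 j).const_mul a), he2,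
      integral_const_mul, integral_const_mul, he1, he1, integral_const, haa]
    simp
  have hsq : ∀ ω, (∑ k ∈ Finset.range n, (Real.exp (X k ω) - a)) ^ 2
      = ∑ j ∈ Finset.range n, ∑ k ∈ Finset.range n,
        (Real.exp (X j ω) - a) * (Real.exp (X k ω) - a) := fun ω => by
    rw [sq, Finset.sum_mul_sum]
  simp_rw [hsq]
  have hi4 : ∀ j, Integrable (fun ω => ∑ k ∈ Finset.range n,
      (Real.exp (X j ω) - a) * (Real.exp (X k ω) - a)) P := fun j =>
    integrable_finsetSum _ fun k _ => hi3 j k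
  refine ⟨integrable_finsetSum _ fun j _ => hi4 j, ?_⟩
  rw [integral_finsetSum _ fun j _ => hi4 j]
  have hb : ∀ j ∈ Finset.range n, ∫ ω, ∑ k ∈ Finset.range n,
      (Real.exp (X j ω) - a) * (Real.exp (X k ω) - a) ∂P
        ≤ (Real.exp 2 - Real.exp 1) + n * (Real.exp (1 + η) - Real.exp 1) := by
    intro j hj
    rw [integral_finsetSum _ fun k _ => hi3 j k]
    have hη' : 0 ≤ Real.exp (1 + η) - Real.exp 1 :=
      sub_nonneg.2 (Real.exp_le_exp.2 (by linarith))
    have h2 : 0 ≤ Real.exp 2 - Real.exp 1 := sub_nonneg.2 (Real.exp_le_exp.2 (by norm_num))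
    -- The diagonal covariance is 1, giving exp 2 - exp 1. The off-diagonal bound is nonnegative, so
    -- it may be added on the diagonal too.
    calc _ ≤ ∑ k ∈ Finset.range n, ((if k = j then Real.exp 2 - Real.exp 1 else 0)
            + (Real.exp (1 + η) - Real.exp 1)) := by
          refine Finset.sum_le_sum fun k _ => ?_
          rw [he3]
          split_ifs with h
          · rw [h, covariance_self (hl j).aemeasurable, h1]
            norm_num
            linarith
          · have := hc j k (Ne.symm h)
            rw [zero_add]
            gcongr
      _ = _ := by
          rw [Finset.sum_add_distrib, Finset.sum_ite_eq', if_pos hj]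
          simp [mul_sub]
  calc _ ≤ ∑ j ∈ Finset.range n,
        ((Real.exp 2 - Real.exp 1) + n * (Real.exp (1 + η) - Real.exp 1)) := Finset.sum_le_sum hb
    _ = _ := by
        rw [Finset.sum_const, Finset.card_range, nsmul_eq_mul]; ring

/-- On `S` each exp(X_k) is at most e^{1/4}, below its mean e^{1/2}, so the centred sum of n terms
is at most -n d. Chebyshev's inequality bounds the probability, and n → ∞ removes the diagonal
contribution. -/
lemma measureReal_forall_le_le {X : ℕ → Ω → ℝ} {η : ℝ} (hη : 0 ≤ η)
    (hX : IsGaussianProcess X P)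
    (h0 : ∀ k, P[X k] = 0) (h1 : ∀ k, Var[X k; P] = 1)
    (hc : ∀ j k, j ≠ k → cov[X j, X k; P] ≤ η) {S : Set Ω} (hS : ∀ ω ∈ S, ∀ k, X k ω ≤ 1 / 4) :
    P.real S ≤ (Real.exp (1 + η) - Real.exp 1) / (Real.exp (1 / 2) - Real.exp (1 / 4)) ^ 2 := by
  set d := Real.exp (1 / 2) - Real.exp (1 / 4) with hd
  have hdpos : 0 < d := sub_pos.2 (Real.exp_lt_exp.2 (by norm_num))
  have key : ∀ n : ℕ, 0 < n → P.real S ≤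
      ((Real.exp 2 - Real.exp 1) / n + (Real.exp (1 + η) - Real.exp 1)) / d ^ 2 := by
    intro n hn
    have hn' : (0 : ℝ) < n := by exact_mod_cast hn
    obtain ⟨hi, hle⟩ := integral_sum_exp_sub_sq_le hη hX h0 h1 hc n
    have hm := mul_meas_ge_le_integral_of_nonneg (.of_forall fun ω => sq_nonneg _) hi ((n * d) ^ 2)
    have hsub : P.real S ≤ P.real {ω | (n * d) ^ 2 ≤
        (∑ k ∈ Finset.range n, (Real.exp (X k ω) - Real.exp (1 / 2))) ^ 2} := by
      refine measureReal_mono fun ω hω => ?_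
      have hsum : ∑ k ∈ Finset.range n, (Real.exp (X k ω) - Real.exp (1 / 2)) ≤ -(n * d) := by
        calc _ ≤ ∑ k ∈ Finset.range n, (-d) := by
              refine Finset.sum_le_sum fun k _ => ?_
              have := Real.exp_le_exp.2 (hS ω hω k)
              linarith
          _ = _ := by simp
      have : 0 < n * d := by positivity
      change (n * d) ^ 2 ≤ _
      rw [← neg_sq (∑ k ∈ Finset.range n, _)]
      exact pow_le_pow_left₀ this.le (by linarith) 2
    rw [le_div_iff₀ (by positivity)]
    have h3 : (n * d) ^ 2 * P.real S ≤ n * (Real.exp 2 - Real.exp 1)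
        + n ^ 2 * (Real.exp (1 + η) - Real.exp 1) :=
      (mul_le_mul_of_nonneg_left hsub (by positivity)).trans (hm.trans hle)
    have h4 : (n : ℝ) ^ 2 * ((Real.exp 2 - Real.exp 1) / n + (Real.exp (1 + η) - Real.exp 1))
      = n * (Real.exp 2 - Real.exp 1) + n ^ 2 * (Real.exp (1 + η) - Real.exp 1) := by
      field_simp
    rw [← h4] at h3
    have h5 : (n : ℝ) ^ 2 * (P.real S * d ^ 2) ≤
        n ^ 2 * ((Real.exp 2 - Real.exp 1) / n + (Real.exp (1 + η) - Real.exp 1)) := by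
      linarith [h3, show (n * d) ^ 2 * P.real S = n ^ 2 * (P.real S * d ^ 2) by ring]
    exact le_of_mul_le_mul_left h5 (by positivity)
  refine ge_of_tendsto (x := atTop) (f := fun n : ℕ =>
    ((Real.exp 2 - Real.exp 1) / n + (Real.exp (1 + η) - Real.exp 1)) / d ^ 2) ?_
    ((eventually_gt_atTop 0).mono key)
  have := (tendsto_const_div_atTop_nhds_zero_nat (Real.exp 2 - Real.exp 1)).add_const
    (Real.exp (1 + η) - Real.exp 1)
  simpa using this.div_const (d ^ 2)

end Exponentials

/-! ### Fractional Brownian motion reaches every level -/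

/-- Decay of the correlations of a fractional Brownian motion. -/
lemma fractional_correlation_le {H s t : ℝ} (hH0 : 0 < H) (hH1 : H < 1) (hs : 0 < s)
    (hst : s ≤ t) :
    (s ^ (2 * H) + t ^ (2 * H) - |t - s| ^ (2 * H)) / (2 * (s ^ H * t ^ H))
      ≤ (s / t) ^ H / 2 + (s / t) ^ (1 - H) := by
  have ht : 0 < t := hs.trans_le hst
  set r := s / t with hr
  have hr0 : 0 < r := by positivity
  have hr1 : r ≤ 1 := (div_le_one ht).2 hst
  have hsr : s = r * t := by rw [hr]; field_simp
  have hT : 0 < t ^ H := by positivity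
  have hR : 0 < r ^ H := by positivity
  have e1 : s ^ H = r ^ H * t ^ H := by rw [hsr, Real.mul_rpow hr0.le ht.le]
  have e2 : ∀ x : ℝ, 0 ≤ x → x ^ (2 * H) = (x ^ H) ^ 2 := fun x hx => by
    rw [mul_comm, Real.rpow_mul hx, Real.rpow_two]
  have e3 : |t - s| ^ (2 * H) = (1 - r) ^ (2 * H) * (t ^ H) ^ 2 := by
    rw [abs_of_nonneg (by linarith), hsr, ← e2 t ht.le,
      ← Real.mul_rpow (by linarith) ht.le]
    ring_nf
  -- Since 2H ≤ 2 and 1 - r lies in [0, 1], (1 - r)^{2H} ≥ (1 - r)² ≥ 1 - 2r. The case r = 1 is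
  -- separate because the base is then 0.
  have e4 : 1 - 2 * r ≤ (1 - r) ^ (2 * H) := by
    have : (1 - r) ^ (2 : ℝ) ≤ (1 - r) ^ (2 * H) := by
      rcases hr1.eq_or_lt with h | h
      · rw [h]; simp [Real.zero_rpow, hH0.ne']
      · exact Real.rpow_le_rpow_of_exponent_ge (by linarith) (by linarith) (by linarith)
    rw [Real.rpow_two] at this
    nlinarith
  have e5 : r ^ (1 - H) = r / r ^ H := by rw [Real.rpow_sub hr0, Real.rpow_one]
  rw [e3, e2 s hs.le, e2 t ht.le, e1, e5, div_le_iff₀ (by positivity)]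
  have e6 : (r ^ H / 2 + r / r ^ H) * (2 * (r ^ H * t ^ H * t ^ H))
      = (r ^ H * t ^ H) ^ 2 + 2 * r * (t ^ H) ^ 2 := by
    field_simp
  rw [e6]
  nlinarith [mul_le_mul_of_nonneg_right e4 (sq_nonneg (t ^ H))]

namespace IsFractionalBrownian

variable {Ω : Type*} [MeasurableSpace Ω] {H σ : ℝ} {Y : ℝ≥0 → Ω → ℝ} {P : Measure Ω}

lemma variance_eq (hY : IsFractionalBrownian H σ Y P) (hH0 : 0 < H) (t : ℝ≥0) :
    Var[Y t; P] = σ ^ 2 * (t : ℝ) ^ (2 * H) := by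
  rw [← covariance_self (hY.gaussian.aemeasurable t), hY.covariance]
  simp only [sub_self, abs_zero]
  rw [Real.zero_rpow (by positivity)]
  ring

lemma zero_ae_eq (hY : IsFractionalBrownian H σ Y P) (hH0 : 0 < H) : ∀ᵐ ω ∂P, Y 0 ω = 0 := by
  have h := (hY.gaussian.hasGaussianLaw_eval 0).map_eq_gaussianReal
  rw [hY.variance_eq hH0, hY.centered] at h
  have h' : HasLaw (Y 0) (.dirac 0) P := ⟨hY.gaussian.aemeasurable 0, by
    simpa [Real.zero_rpow, hH0.ne', gaussianReal_zero_var] using h⟩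
  exact h'.ae_eq_of_dirac

/-- The path is sampled at the times T L^k and normalised. `T` is so large that b is at most a
quarter of every standard deviation, and the correlations are at most e(L), which tends to 0 as L →
∞. -/
lemma measureReal_forall_le_eq_zero (hY : IsFractionalBrownian H σ Y P) (hH0 : 0 < H) (hH1 : H < 1)
    (hσ : 0 < σ) (b : ℝ) : P.real {ω | ∀ t, Y t ω ≤ b} = 0 := by
  have := hY.gaussian.isProbabilityMeasure
  obtain ⟨T, hTb, hT0⟩ : ∃ T : ℝ, b ≤ σ * T ^ H / 4 ∧ 0 < T :=
    ((((tendsto_rpow_atTop hH0).const_mul_atTop hσ).atTop_div_const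
      (by norm_num : (0 : ℝ) < 4)).eventually_ge_atTop b |>.and (eventually_gt_atTop 0)).exists
  let e : ℝ → ℝ := fun L => (1 / L) ^ H / 2 + (1 / L) ^ (1 - H)
  have key : ∀ L : ℝ, 1 ≤ L → P.real {ω | ∀ t, Y t ω ≤ b}
      ≤ (Real.exp (1 + e L) - Real.exp 1) / (Real.exp (1 / 2) - Real.exp (1 / 4)) ^ 2 := by
    intro L hL
    have hL0 : 0 < L := by linarith
    let t : ℕ → ℝ≥0 := fun k => ⟨T * L ^ k, by positivity⟩
    have ht : ∀ k, (t k : ℝ) = T * L ^ k := fun k => rfl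
    have ht0 : ∀ k, (0 : ℝ) < t k := fun k => by rw [ht]; positivity
    let c : ℕ → ℝ := fun k => (σ * (t k : ℝ) ^ H)⁻¹
    have hc0 : ∀ k, 0 < c k := fun k => by
      have := ht0 k
      positivity
    have hcov : ∀ j k, cov[fun ω => c j • Y (t j) ω, fun ω => c k • Y (t k) ω; P]
        = ((t j : ℝ) ^ (2 * H) + (t k : ℝ) ^ (2 * H) - |(t k : ℝ) - t j| ^ (2 * H))
          / (2 * ((t j : ℝ) ^ H * (t k : ℝ) ^ H)) := by
      intro j k
      simp only [smul_eq_mul]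
      rw [covariance_const_mul_left, covariance_const_mul_right, hY.covariance]
      have h1 : 0 < (t j : ℝ) ^ H := Real.rpow_pos_of_pos (ht0 j) _
      have h2 : 0 < (t k : ℝ) ^ H := Real.rpow_pos_of_pos (ht0 k) _
      simp only [c]
      field_simp
    have hlt : ∀ j k, j < k → cov[fun ω => c j • Y (t j) ω, fun ω => c k • Y (t k) ω; P] ≤ e L := by
      intro j k hjk
      have hjk' : (t j : ℝ) ≤ t k := by
        rw [ht, ht]; gcongr
      rw [hcov]
      refine (fractional_correlation_le hH0 hH1 (ht0 j) hjk').trans ?_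
      have hr : (t j : ℝ) / t k ≤ 1 / L := by
        rw [div_le_div_iff₀ (ht0 k) hL0, ht, ht, one_mul, mul_assoc, ← pow_succ]
        gcongr
        exact hjk
      have hr0 : 0 ≤ (t j : ℝ) / t k := (div_pos (ht0 j) (ht0 k)).le
      have hH1' : 0 ≤ 1 - H := by linarith
      simp only [e]
      gcongr
    refine measureReal_forall_le_le (X := fun k ω => c k • Y (t k) ω) (by positivity)
      ((hY.gaussian.comp_right t).smul c) (fun k => ?_) (fun k => ?_) (fun j k hjk => ?_) ?_
    · simp only [smul_eq_mul]
      rw [integral_const_mul, hY.centered, mul_zero]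
    · rw [← covariance_self, hcov]
      · have h1 : 0 < (t k : ℝ) ^ H := Real.rpow_pos_of_pos (ht0 k) _
        rw [mul_comm 2 H, Real.rpow_mul (ht0 k).le, Real.rpow_two]
        simp only [sub_self, abs_zero]
        rw [Real.zero_rpow (by positivity), sub_zero]
        field_simp
        norm_num
      · exact (hY.gaussian.aemeasurable _).const_smul (c k)
    · rcases lt_or_gt_of_ne hjk with h | h
      · exact hlt j k h
      · rw [covariance_comm]; exact hlt k j h
    · intro ω hω k
      have h1 : 0 < (t k : ℝ) ^ H := Real.rpow_pos_of_pos (ht0 k) _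
      have h2 : T ^ H ≤ (t k : ℝ) ^ H := by
        refine Real.rpow_le_rpow hT0.le ?_ hH0.le
        rw [ht]
        exact le_mul_of_one_le_right hT0.le (one_le_pow₀ hL)
      simp only [smul_eq_mul, c]
      rw [inv_mul_le_iff₀ (by positivity)]
      have h3 := hω (t k)
      have h4 : σ * T ^ H ≤ σ * (t k : ℝ) ^ H := by gcongr
      linarith
  have hlim : Tendsto e atTop (𝓝 0) := by
    have h1 : Tendsto (fun L : ℝ => 1 / L) atTop (𝓝 0) := by
      simpa using tendsto_inv_atTop_zero (𝕜 := ℝ)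
    have h2 : ∀ p : ℝ, 0 < p → Tendsto (fun L : ℝ => (1 / L) ^ p) atTop (𝓝 0) := fun p hp => by
      have := h1.rpow_const (p := p) (.inr hp.le)
      rwa [Real.zero_rpow hp.ne'] at this
    have h3 := ((h2 H hH0).div_const 2).add (h2 (1 - H) (sub_pos.2 hH1))
    rwa [zero_div, add_zero] at h3
  refine le_antisymm ?_ measureReal_nonneg
  refine ge_of_tendsto (x := atTop) (f := fun L => (Real.exp (1 + e L) - Real.exp 1)
    / (Real.exp (1 / 2) - Real.exp (1 / 4)) ^ 2) ?_ ((eventually_ge_atTop 1).mono key)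
  have := ((Real.continuous_exp.tendsto _).comp (hlim.const_add 1)).sub_const (Real.exp 1)
  simpa using this.div_const ((Real.exp (1 / 2) - Real.exp (1 / 4)) ^ 2)

/-- A fractional Brownian motion visits every level. -/
lemma ae_forall_exists_eq (hY : IsFractionalBrownian H σ Y P) (hH0 : 0 < H) (hH1 : H < 1)
    (hσ : 0 < σ) : ∀ᵐ ω ∂P, ∀ t : ℝ≥0, ∃ s : ℝ≥0, Y s ω = t := by
  have := hY.gaussian.isProbabilityMeasure
  have hb : ∀ᵐ ω ∂P, ∀ n : ℕ, ∃ t, (n : ℝ) < Y t ω := by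
    refine ae_all_iff.2 fun n => ?_
    have h := hY.measureReal_forall_le_eq_zero hH0 hH1 hσ n
    rw [measureReal_eq_zero_iff] at h
    filter_upwards [measure_eq_zero_iff_ae_notMem.1 h] with ω hω
    simpa using hω
  filter_upwards [hb, hY.zero_ae_eq hH0, hY.cont] with ω h1 h2 h3 t
  obtain ⟨n, hn⟩ := exists_nat_ge (t : ℝ)
  obtain ⟨u, hu⟩ := h1 n
  have := intermediate_value_univ 0 u h3
  exact this ⟨by simp [h2], (hn.trans hu.le)⟩

end IsFractionalBrownian

/-! ### Transfer to the product space -/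

lemma ProbabilityTheory.IsPreBrownianReal.comp_measurePreserving {Ω Ω' : Type*} [MeasurableSpace Ω]
    [MeasurableSpace Ω'] {P : Measure Ω} {Q : Measure Ω'} {X : ℝ≥0 → Ω → ℝ}
    (hX : IsPreBrownianReal X P) {f : Ω' → Ω} (hf : MeasurePreserving f Q P) :
    IsPreBrownianReal (fun t p => X t (f p)) Q where
  hasLaw I := (hX.hasLaw I).comp hf.hasLaw

/-- Measurable representatives make the coincidence set measurable, as Fubini requires to pass from
slices to the product. -/
lemma ae_eq_prod_of_ae_ae_eq {α β : Type*} [MeasurableSpace α] [MeasurableSpace β]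
    {μ : Measure α} {ν : Measure β} [SFinite μ] [SFinite ν] {f g : α × β → ℝ}
    (hf : AEMeasurable f (μ.prod ν)) (hg : AEMeasurable g (μ.prod ν))
    (h : ∀ᵐ y ∂ν, ∀ᵐ x ∂μ, f (x, y) = g (x, y)) : f =ᵐ[μ.prod ν] g := by
  have hswap := Measure.measurePreserving_swap (μ := ν) (ν := μ)
  have hfm : ∀ᵐ y ∂ν, ∀ᵐ x ∂μ, f (x, y) = hf.mk f (x, y) :=
    Measure.ae_ae_of_ae_prod (hswap.quasiMeasurePreserving.ae hf.ae_eq_mk)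
  have hgm : ∀ᵐ y ∂ν, ∀ᵐ x ∂μ, g (x, y) = hg.mk g (x, y) :=
    Measure.ae_ae_of_ae_prod (hswap.quasiMeasurePreserving.ae hg.ae_eq_mk)
  have hms : MeasurableSet {p | hf.mk f p = hg.mk g p} :=
    measurableSet_eq_fun hf.measurable_mk hg.measurable_mk
  have h2 : ∀ᵐ p ∂(μ.prod ν), hf.mk f p = hg.mk g p := by
    refine (Measure.ae_prod_iff_ae_ae hms).2 ((Measure.ae_ae_comm hms).2 ?_)
    filter_upwards [h, hfm, hgm] with y h1 h2 h3
    filter_upwards [h1, h2, h3] with x h1 h2 h3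
    rw [← h2, ← h3, h1]
  filter_upwards [hf.ae_eq_mk, hg.ae_eq_mk, h2] with p h1 h2 h3
  rw [h1, h2, h3]

/-! ### Measurability of first level times -/

section FirstLevelTime

variable {Ω : Type*} {Y : ℝ≥0 → Ω → ℝ} {ω : Ω} {t : ℝ≥0}

lemma apply_firstLevelTime (hc : Continuous fun s => Y s ω) (h : ∃ s, Y s ω = t) :
    Y (firstLevelTime Y t ω) ω = t :=
  (isClosed_eq hc continuous_const : IsClosed {s : ℝ≥0 | Y s ω = (t : ℝ)}).csInf_mem h
    (OrderBot.bddBelow _)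

/-- Starting from 0, a continuous path has met level t by time s exactly when its maximum on [0, s]
is at least t. The right side says so with countably many times; the slack 1/(n+1) is there because
these may miss the maximum. -/
lemma firstLevelTime_le_iff (hc : Continuous fun s => Y s ω) (h0 : Y 0 ω = 0)
    (h : ∃ s, Y s ω = t) (s : ℝ≥0) :
    firstLevelTime Y t ω ≤ s ↔ ∀ n : ℕ, ∃ k : ℕ,
      (t : ℝ) - 1 / (n + 1) < Y (min s (TopologicalSpace.denseSeq ℝ≥0 k)) ω := by
  constructor
  · intro hle n
    have hc' : Continuous fun v => Y (min s v) ω := hc.comp (continuous_const.min continuous_id)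
    obtain ⟨k, hk⟩ := (TopologicalSpace.denseRange_denseSeq ℝ≥0).exists_mem_open
      (isOpen_lt continuous_const hc' :
        IsOpen {v | (t : ℝ) - 1 / (n + 1) < Y (min s v) ω})
      ⟨firstLevelTime Y t ω, by
        rw [Set.mem_ofPred_eq, min_eq_right hle, apply_firstLevelTime hc h]
        have : (0 : ℝ) < 1 / (n + 1) := by positivity
        linarith⟩
    exact ⟨k, hk⟩
  · intro hk
    obtain ⟨u, hu, hmax⟩ := (isCompact_Icc (a := (0 : ℝ≥0)) (b := s)).exists_isMaxOn
      ⟨0, by simp⟩ hc.continuousOn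
    have htu : (t : ℝ) ≤ Y u ω := by
      refine ge_of_tendsto' (x := atTop) (f := fun n : ℕ => Y u ω + 1 / ((n : ℝ) + 1)) ?_
        fun n => ?_
      · simpa using tendsto_one_div_add_atTop_nhds_zero_nat.const_add (Y u ω)
      · obtain ⟨k, hk⟩ := hk n
        have : Y (min s (TopologicalSpace.denseSeq ℝ≥0 k)) ω ≤ Y u ω := hmax (by simp)
        linarith
    obtain ⟨v, hv, hvt⟩ := intermediate_value_Icc hu.1 hc.continuousOn
      (show (t : ℝ) ∈ Set.Icc (Y 0 ω) (Y u ω) from ⟨by simp [h0], htu⟩)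
    exact (csInf_le (OrderBot.bddBelow _) (show v ∈ {s : ℝ≥0 | Y s ω = (t : ℝ)} from hvt)).trans (hv.2.trans hu.2)

lemma aemeasurable_firstLevelTime [MeasurableSpace Ω] {P : Measure Ω}
    (hY : ∀ s, AEMeasurable (Y s) P)
    (hc : ∀ᵐ ω ∂P, Continuous fun s => Y s ω) (h0 : ∀ᵐ ω ∂P, Y 0 ω = 0)
    (h : ∀ᵐ ω ∂P, ∃ s, Y s ω = t) : AEMeasurable (firstLevelTime Y t) P := by
  obtain ⟨Y', hY'm, hY'c, hYY'⟩ := exists_continuous_measurable_of_ae hY hc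
  have hgood : ∀ᵐ ω ∂P, Y' 0 ω = 0 ∧ ∃ s, Y' s ω = t := by
    filter_upwards [h0, h, hYY'] with ω h1 h2 h3
    simpa only [h3] using And.intro h1 h2
  obtain ⟨N, hN, hNm, hN0⟩ := exists_measurable_superset_of_null hgood
  have hN' : ∀ ω ∉ N, Y' 0 ω = 0 ∧ ∃ s, Y' s ω = t := fun ω hω => by
    by_contra hcon
    exact hω (hN hcon)
  refine ⟨Nᶜ.indicator (firstLevelTime Y' t), measurable_of_Iic fun s => ?_, ?_⟩
  · have : Nᶜ.indicator (firstLevelTime Y' t) ⁻¹' Set.Iic s = N ∪ (⋂ n : ℕ, ⋃ k : ℕ,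
        {ω | (t : ℝ) - 1 / (n + 1) < Y' (min s (TopologicalSpace.denseSeq ℝ≥0 k)) ω}) := by
      ext ω
      by_cases hω : ω ∈ N
      · simp [hω]
      · simp only [Set.mem_preimage, Set.mem_compl_iff, hω, not_false_eq_true,
          Set.indicator_of_mem, Set.mem_Iic, Set.mem_union, false_or, Set.mem_iInter,
          Set.mem_iUnion, Set.mem_ofPred_eq]
        exact firstLevelTime_le_iff (hY'c ω) (hN' ω hω).1 (hN' ω hω).2 s
    rw [this]
    exact hNm.union (.iInter fun n => .iUnion fun k => measurableSet_lt measurable_const (hY'm _))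
  · filter_upwards [measure_eq_zero_iff_ae_notMem.1 hN0, hYY'] with ω hω h
    simp [hω, firstLevelTime, h]

end FirstLevelTime

/-! ### The time-changed process -/

theorem proposition6 {Ω Ω' : Type*} [MeasurableSpace Ω] [MeasurableSpace Ω']
    (P : Measure Ω) [IsProbabilityMeasure P] (P' : Measure Ω') [IsProbabilityMeasure P']
    (H σ : ℝ) (hH0 : 0 < H) (hH1 : H < 1) (hσ : 0 < σ)
    (Y : ℝ≥0 → Ω' → ℝ) (hY : IsFractionalBrownian H σ Y P')
    (M : Set ℝ → Ω → ℝ) (hM : IsGaussianRandomMeasure M volume P) :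
    (∀ᵐ ω' ∂P', ∀ t : ℝ≥0, ∃ s : ℝ≥0, Y s ω' = t) ∧
    (∃ Z : ℝ≥0 → Ω × Ω' → ℝ, IsContinuousRandomTimeProcess M P Y P' Z ∧
      IsPathwiseRandomTimeProcess M P Y P' Z) ∧
    (∀ Z : ℝ≥0 → Ω × Ω' → ℝ, IsContinuousRandomTimeProcess M P Y P' Z →
      IsBrownianReal (fun t p => Z (firstLevelTime Y t p.2) p) (P.prod P')) ∧
    (∀ Z : ℝ≥0 → Ω × Ω' → ℝ, IsPathwiseRandomTimeProcess M P Y P' Z →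
      IsPreBrownianReal (fun t p => Z (firstLevelTime Y t p.2) p) (P.prod P')) := by
  have hlevel := hY.ae_forall_exists_eq hH0 hH1 hσ
  obtain ⟨B, hBm, hBc, hBM⟩ := hM.exists_continuous_version
  obtain ⟨Y', hY'm, hY'c, hYY'⟩ :=
    exists_continuous_measurable_of_ae hY.gaussian.aemeasurable hY.cont
  have hBm' : Measurable (Function.uncurry B) :=
    measurable_uncurry_of_continuous_of_measurable hBc hBm
  have hY'm' : Measurable (Function.uncurry Y') :=
    measurable_uncurry_of_continuous_of_measurable hY'c hY'm
  have hB : IsPreBrownianReal (fun t p => B (t : ℝ) p.1) (P.prod P') :=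
    (hM.isPreBrownianReal.congr fun t => (hBM t).symm).comp_measurePreserving
      measurePreserving_fst
  have hlevelτ : ∀ᵐ ω' ∂P', ∀ t, Y (firstLevelTime Y t ω') ω' = t := by
    filter_upwards [hlevel, hY.cont] with ω' h1 h2 t
    exact apply_firstLevelTime h2 (h1 t)
  -- The canonical version B(Y_t), with `Y'` in place of `Y` so that joint measurability and
  -- continuity hold everywhere.
  let Z₀ : ℝ≥0 → Ω × Ω' → ℝ := fun t p => B (Y' t p.2) p.1
  have hZ₀m : Measurable (fun q : ℝ≥0 × (Ω × Ω') => Z₀ q.1 q.2) :=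
    hBm'.comp ((hY'm'.comp (measurable_fst.prodMk measurable_snd.snd)).prodMk measurable_snd.fst)
  have hZ₀m' : ∀ t, Measurable (Z₀ t) := fun t => hZ₀m.comp (measurable_const.prodMk measurable_id)
  have hZ₀c : ∀ p, Continuous fun t => Z₀ t p := fun p => (hBc p.1).comp (hY'c p.2)
  have hZ₀M : ∀ᵐ ω' ∂P', ∀ t, (fun ω => Z₀ t (ω, ω')) =ᵐ[P] M (Set.uIcc 0 (Y t ω')) := by
    filter_upwards [hYY'] with ω' h t
    rw [h t]
    exact hBM (Y' t ω')
  have hZ₀i : ∀ᵐ ω' ∂P', ∀ t,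
      IsRandomMeasureIntegral M volume P (intervalKernel (Y t ω')) (fun ω => Z₀ t (ω, ω')) := by
    filter_upwards [hZ₀M] with ω' h t
    exact hM.isRandomMeasureIntegral_of_ae_eq measurableSet_uIcc (volume_uIcc_zero_lt_top _) (h t)
  refine ⟨hlevel, ⟨Z₀, ⟨fun t => ⟨(hZ₀m' t).aemeasurable, hZ₀i.mono fun ω' h => h t⟩,
    .of_forall hZ₀c⟩, hZ₀m, hZ₀i⟩, fun Z hZ => ?_, fun Z hZ => ?_⟩
  · have hZt : ∀ t, Z t =ᵐ[P.prod P'] Z₀ t := fun t => by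
      refine ae_eq_prod_of_ae_ae_eq (hZ.integral t).1 (hZ₀m' t).aemeasurable ?_
      filter_upwards [(hZ.integral t).2, hZ₀M] with ω' h1 h2
      exact (hM.ae_eq_of_isRandomMeasureIntegral measurableSet_uIcc (volume_uIcc_zero_lt_top _)
        h1).trans (h2 t).symm
    have hZall : ∀ᵐ p ∂(P.prod P'), ∀ t, Z t p = Z₀ t p := by
      filter_upwards [hZ.cont, ae_all_iff.2 fun k => hZt (TopologicalSpace.denseSeq ℝ≥0 k)]
        with p h1 h2 t
      refine congrFun (Continuous.ext_on (TopologicalSpace.denseRange_denseSeq ℝ≥0) h1 (hZ₀c p)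
        ?_) t
      rintro _ ⟨k, rfl⟩
      exact h2 k
    have hZB : ∀ᵐ p ∂(P.prod P'), ∀ t : ℝ≥0, B (t : ℝ) p.1 = Z (firstLevelTime Y t p.2) p := by
      filter_upwards [hZall, Measure.quasiMeasurePreserving_snd.ae hlevelτ,
        Measure.quasiMeasurePreserving_snd.ae hYY'] with p h1 h2 h3 t
      simp only [h1, Z₀, ← h3, h2]
    refine { toIsPreBrownianReal := hB.congr fun t => hZB.mono fun p h => h t, cont := ?_ }
    filter_upwards [hZB] with p h
    simp_rw [← h]
    exact (hBc p.1).comp NNReal.continuous_coe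
  · refine hB.congr fun t => ?_
    have hτ : AEMeasurable (firstLevelTime Y t) P' :=
      aemeasurable_firstLevelTime hY.gaussian.aemeasurable hY.cont (hY.zero_ae_eq hH0)
        (hlevel.mono fun ω h => h t)
    have hZτ : AEMeasurable (fun p : Ω × Ω' => Z (firstLevelTime Y t p.2) p) (P.prod P') :=
      hZ.measurable.comp_aemeasurable ((hτ.comp_quasiMeasurePreserving
        Measure.quasiMeasurePreserving_snd).prodMk aemeasurable_id)
    refine ae_eq_prod_of_ae_ae_eq ((hBm t).comp measurable_fst).aemeasurable hZτ ?_
    filter_upwards [hZ.integral, hlevelτ] with ω' h1 h2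
    -- For fixed ω' the time τ_t(ω') is deterministic, and the formula holds at all times for this
    -- ω', so it may be used there.
    have h3 := hM.ae_eq_of_isRandomMeasureIntegral measurableSet_uIcc (volume_uIcc_zero_lt_top _)
      (h1 (firstLevelTime Y t ω'))
    rw [h2] at h3
    filter_upwards [h3, hBM t] with ω h4 h5
    rw [h4, h5]
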